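/- Let $\mathcal{X}$ and $\mathcal{Y}$ be complex Hilbert spaces of the same finite dimension $d$, and write $L(\mathcal{X})$, $L(\mathcal{Y})$ for the spaces of linear operators on them. Let $\Phi : L(\mathcal{X}) \to L(\mathcal{Y})$ be a doubly stochastic channel, that is, a linear map that is completely positive, trace-preserving, and unital ($\Phi(\mathbb{1}_{\mathcal{X}}) = \mathbb{1}_{\mathcal{Y}}$), and let $\Omega : L(\mathcal{X}) \to L(\mathcal{Y})$, $\Omega(A) = \frac{\operatorname{Tr}(A)}{d}\,\mathbb{1}_{\mathcal{Y}}$, be the completely depolarizing channel. Then for every real $p$ with $0 \le p \le 1/(d^2-1)$ (for $d = 1$, where the upper bound is read as $+\infty$: for every $p \ge 0$), the map \[ p\,\Phi + (1-p)\,\Omega \] is a mixed-unitary channel: there are a positive integer $N$, unitary maps $U_1,\dots,U_N : \mathcal{X} \to \mathcal{Y}$ and a probability distribution $(q_1,\dots,q_N)$ such that \[ p\,\Phi(A) + (1-p)\,\Omega(A) = \sum_{i=1}^N q_i\, U_i A U_i^{*} \qquad \text{for all } A \in L(\mathcal{X}). \] -/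

import Mathlib

noncomputable section QuantumChannels

variable {X Y : Type*}
  [NormedAddCommGroup X] [InnerProductSpace ℂ X] [FiniteDimensional ℂ X] [CompleteSpace X]
  [NormedAddCommGroup Y] [InnerProductSpace ℂ Y] [FiniteDimensional ℂ Y] [CompleteSpace Y]

/-- A super-operator `Φ : L(X) → L(Y)` is completely positive, in Mathlib's sense: applying `Φ`
to all entries of a positive `k × k` operator matrix gives a positive operator matrix,
for every `k`. -/
def IsCompletelyPositive (Φ : (X →L[ℂ] X) →ₗ[ℂ] (Y →L[ℂ] Y)) : Prop :=
  ∃ F : CompletelyPositiveMap (X →L[ℂ] X) (Y →L[ℂ] Y), F.toLinearMap = Φ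

/-- `Φ` preserves the trace. -/
def IsTracePreserving (Φ : (X →L[ℂ] X) →ₗ[ℂ] (Y →L[ℂ] Y)) : Prop :=
  ∀ A : X →L[ℂ] X,
    LinearMap.trace ℂ Y (Φ A : Y →ₗ[ℂ] Y) = LinearMap.trace ℂ X (A : X →ₗ[ℂ] X)

/-- A doubly stochastic channel: completely positive, trace-preserving and unital. -/
structure IsDoublyStochastic (Φ : (X →L[ℂ] X) →ₗ[ℂ] (Y →L[ℂ] Y)) : Prop where
  completelyPositive : IsCompletelyPositive Φ
  tracePreserving : IsTracePreserving Φ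
  unital : Φ 1 = 1

/-- A mixed-unitary channel: a finite convex combination `A ↦ ∑ i, q i • U i A (U i)⋆` of
conjugations by unitary maps `U i : X → Y`. -/
def IsMixedUnitary (Φ : (X →L[ℂ] X) →ₗ[ℂ] (Y →L[ℂ] Y)) : Prop :=
  ∃ (N : ℕ) (q : Fin N → ℝ) (U : Fin N → (X ≃ₗᵢ[ℂ] Y)),
    (∀ i, 0 ≤ q i) ∧ ∑ i, q i = 1 ∧
      ∀ A : X →L[ℂ] X, Φ A = ∑ i, q i •
        ((U i : X →L[ℂ] Y) ∘L A ∘L ContinuousLinearMap.adjoint (U i : X →L[ℂ] Y))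

/-- The completely depolarizing channel `A ↦ (Tr A / dim Y) • 1`. -/
def completelyDepolarizing (X Y : Type*)
    [NormedAddCommGroup X] [InnerProductSpace ℂ X]
    [NormedAddCommGroup Y] [InnerProductSpace ℂ Y] :
    (X →L[ℂ] X) →ₗ[ℂ] (Y →L[ℂ] Y) where
  toFun A := (LinearMap.trace ℂ X (A : X →ₗ[ℂ] X) / (Module.finrank ℂ Y : ℂ)) • 1
  map_add' A B := by simp [add_div, add_smul]
  map_smul' c A := by simp [mul_div_assoc, mul_smul]

end QuantumChannels

/-
Identify `X` with `Y` by a unitary map, let `d` be the common dimension and let `Ad_u` be the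
conjugation `A ↦ u A u⋆`, an operator on `L(X)`. For `d ≥ 2` consider the weight
`w(u) = Tr(Ad_u⁻¹ ∘ Φ)`, the trace being that of an operator on `L(X)`. Complete positivity of `Φ`
makes `w` nonnegative: `Tr Φ = ∑ i j, ⟨b i, Φ(|b i⟩⟨b j|) b j⟩`, and the block matrix
`(|b i⟩⟨b j|)` is positive. The integral of `w(u) Ad_u` over Haar measure is a sum of twirls
`∫ Ad_u K Ad_u⁻¹ du`; a twirl commutes with every `Ad_u`, hence is a combination of the identity
and `A ↦ Tr(A) 1`, with coefficients determined by two traces. This gives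
`∫ w(u) Ad_u du = (Φ + (d² - 2) Ω) / (d² - 1)` and `∫ w(u) du = 1`. As the convex hull of the
compact set of all `Ad_u` is compact by Carathéodory's theorem, it contains the integral, so the
right-hand side is mixed-unitary. The same holds for `Ω`, whose weight is constantly `1`, and
`p Φ + (1 - p) Ω` with `p ≤ 1 / (d² - 1)` lies on the segment between the two.
-/

section Trace

/-- The trace as a continuous linear functional on the bounded operators of a finite-dimensional
space `V`. It is applied both to `V = X` and to `V = L(X)`. -/
noncomputable def traceCLM (V : Type*) [NormedAddCommGroup V] [NormedSpace ℂ V]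
    [FiniteDimensional ℂ V] : (V →L[ℂ] V) →L[ℂ] ℂ :=
  LinearMap.toContinuousLinearMap (LinearMap.trace ℂ V ∘ₗ ContinuousLinearMap.coeLM ℂ)

variable {V : Type*} [NormedAddCommGroup V] [NormedSpace ℂ V] [FiniteDimensional ℂ V]

theorem traceCLM_apply (A : V →L[ℂ] V) :
    traceCLM V A = LinearMap.trace ℂ V (A : V →ₗ[ℂ] V) := rfl

theorem traceCLM_mul_comm (A B : V →L[ℂ] V) : traceCLM V (A * B) = traceCLM V (B * A) :=
  LinearMap.trace_mul_comm ℂ (A : V →ₗ[ℂ] V) B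

theorem traceCLM_mul_mul_of_mul_eq_one {U U' : V →L[ℂ] V} (h : U' * U = 1) (A : V →L[ℂ] V) :
    traceCLM V (U * A * U') = traceCLM V A := by
  rw [traceCLM_mul_comm, ← mul_assoc, h, one_mul]

theorem traceCLM_one : traceCLM V 1 = Module.finrank ℂ V :=
  LinearMap.trace_one ℂ V

theorem traceCLM_smulRight (f : V →L[ℂ] ℂ) (v : V) : traceCLM V (f.smulRight v) = f v :=
  LinearMap.trace_smulRight (f : V →ₗ[ℂ] ℂ) v

theorem traceCLM_eq_sum_coord {ι : Type*} [Fintype ι] (b : Module.Basis ι ℂ V) (A : V →L[ℂ] V) :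
    traceCLM V A = ∑ k, b.coord k (A (b k)) := by
  classical
  simp [traceCLM_apply, LinearMap.trace_eq_matrix_trace ℂ b, Matrix.trace, LinearMap.toMatrix_apply]

end Trace

section Twirl

open MeasureTheory

theorem exists_isProbabilityMeasure_isMulLeftInvariant (G : Type*) [Group G] [TopologicalSpace G]
    [IsTopologicalGroup G] [CompactSpace G] [MeasurableSpace G] [BorelSpace G] :
    ∃ μ : Measure G, IsProbabilityMeasure μ ∧ μ.IsMulLeftInvariant :=
  ⟨Measure.haarMeasure ⊤, ⟨Measure.haarMeasure_self⟩, inferInstance⟩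

variable {G V : Type*} [Group G] [TopologicalSpace G] [IsTopologicalGroup G] [CompactSpace G]
  [MeasurableSpace G] [BorelSpace G] [NormedAddCommGroup V] [NormedSpace ℂ V]
  [FiniteDimensional ℂ V]

omit [Group G] [IsTopologicalGroup G] in
theorem integrable_of_continuous_of_compactSpace {E : Type*} [NormedAddCommGroup E]
    {μ : Measure G} [IsFiniteMeasure μ] {f : G → E} (hf : Continuous f) : Integrable f μ :=
  hf.integrable_of_hasCompactSupport (HasCompactSupport.of_compactSpace f)

/-- The twirl of an operator `K` under a representation `ρ`: the average of the conjugates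
`ρ g * K * ρ g⁻¹`. -/
noncomputable def twirl (μ : Measure G) (ρ : G →* (V →L[ℂ] V)) (K : V →L[ℂ] V) : V →L[ℂ] V :=
  ∫ g, ρ g * K * ρ g⁻¹ ∂μ

variable {ρ : G →* (V →L[ℂ] V)} (μ : Measure G)

theorem map_twirl [IsFiniteMeasure μ] (hρ : Continuous ρ) {E : Type*} [NormedAddCommGroup E]
    [NormedSpace ℂ E] [CompleteSpace E] (L : (V →L[ℂ] V) →L[ℂ] E) (K : V →L[ℂ] V) :
    L (twirl μ ρ K) = ∫ g, L (ρ g * K * ρ g⁻¹) ∂μ :=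
  (L.integral_comp_comm (integrable_of_continuous_of_compactSpace (by fun_prop))).symm

theorem commute_twirl [IsFiniteMeasure μ] [μ.IsMulLeftInvariant] (hρ : Continuous ρ) (h : G)
    (K : V →L[ℂ] V) : Commute (ρ h) (twirl μ ρ K) := by
  have conj_eq : ρ h * twirl μ ρ K * ρ h⁻¹ = twirl μ ρ K := calc
    _ = ∫ g, ρ h * (ρ g * K * ρ g⁻¹) * ρ h⁻¹ ∂μ :=
      map_twirl μ hρ (ContinuousLinearMap.mulLeftRight ℂ (V →L[ℂ] V) (ρ h) (ρ h⁻¹)) K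
    _ = ∫ g, ρ (h * g) * K * ρ (h * g)⁻¹ ∂μ := by
      simp only [map_mul, mul_inv_rev, mul_assoc]
    _ = twirl μ ρ K := integral_mul_left_eq_self (fun g ↦ ρ g * K * ρ g⁻¹) h
  calc ρ h * twirl μ ρ K = ρ h * twirl μ ρ K * (ρ h⁻¹ * ρ h) := by
        rw [← map_mul, inv_mul_cancel, map_one, mul_one]
    _ = twirl μ ρ K * ρ h := by rw [← mul_assoc, conj_eq]

theorem traceCLM_twirl [IsProbabilityMeasure μ] (hρ : Continuous ρ) (K : V →L[ℂ] V) :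
    traceCLM V (twirl μ ρ K) = traceCLM V K := by
  have traceCLM_conj (g : G) : traceCLM V (ρ g * K * ρ g⁻¹) = traceCLM V K :=
    traceCLM_mul_mul_of_mul_eq_one (by rw [← map_mul, inv_mul_cancel, map_one]) K
  simp [map_twirl μ hρ, traceCLM_conj]

theorem integral_traceCLM_smul_apply [IsFiniteMeasure μ] (hρ : Continuous ρ) {ι : Type*}
    [Fintype ι] (b : Module.Basis ι ℂ V) (T : V →L[ℂ] V) (v : V) :
    (∫ g, traceCLM V (ρ g⁻¹ * T) • ρ g ∂μ) v =
      ∑ k, twirl μ ρ ((b.coord k).toContinuousLinearMap.smulRight v) (T (b k)) := by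
  have twirl_smulRight_apply (k : ι) :
      twirl μ ρ ((b.coord k).toContinuousLinearMap.smulRight v) (T (b k)) =
        ∫ g, b.coord k (ρ g⁻¹ (T (b k))) • ρ g v ∂μ := by
    simpa using map_twirl μ hρ (ContinuousLinearMap.apply ℂ V (T (b k)))
      ((b.coord k).toContinuousLinearMap.smulRight v)
  have continuous_summand (k : ι) :
      Continuous fun g ↦ b.coord k (ρ g⁻¹ (T (b k))) • ρ g v := by
    have := (b.coord k).continuous_of_finiteDimensional
    fun_prop
  calc (∫ g, traceCLM V (ρ g⁻¹ * T) • ρ g ∂μ) v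
      = ∫ g, traceCLM V (ρ g⁻¹ * T) • ρ g v ∂μ :=
        ContinuousLinearMap.integral_apply
          (integrable_of_continuous_of_compactSpace (by fun_prop)) v
    _ = ∫ g, ∑ k, b.coord k (ρ g⁻¹ (T (b k))) • ρ g v ∂μ := by
        simp only [traceCLM_eq_sum_coord b, Finset.sum_smul, mul_apply_eq_comp]
    _ = ∑ k, twirl μ ρ ((b.coord k).toContinuousLinearMap.smulRight v) (T (b k)) := by
        simp only [twirl_smulRight_apply]
        exact integral_finsetSum _ fun k _ ↦
          integrable_of_continuous_of_compactSpace (continuous_summand k)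

end Twirl

section UnitaryConj

open ContinuousLinearMap

variable {𝒜 : Type*} [CStarAlgebra 𝒜]

/-- The conjugation action `a ↦ u * a * star u` of the unitary group of a C⋆-algebra, as a
representation on the underlying Banach space. -/
noncomputable def unitaryConj : unitary 𝒜 →* (𝒜 →L[ℂ] 𝒜) where
  toFun u := mulLeftRight ℂ 𝒜 u (star (u : 𝒜))
  map_one' := by ext; simp
  map_mul' u v := by ext; simp [mul_assoc]

@[simp]
theorem unitaryConj_apply (u : unitary 𝒜) (a : 𝒜) :
    unitaryConj u a = u * a * star (u : 𝒜) := rfl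

theorem continuous_unitaryConj : Continuous (unitaryConj : unitary 𝒜 → (𝒜 →L[ℂ] 𝒜)) := by
  change Continuous fun u : unitary 𝒜 ↦ mulLeftRight ℂ 𝒜 u (star (u : 𝒜))
  fun_prop

theorem unitaryConj_apply_one (u : unitary 𝒜) : unitaryConj u 1 = 1 := by
  simp

theorem unitaryConj_apply_eq_self_iff {u : unitary 𝒜} {a : 𝒜} :
    unitaryConj u a = a ↔ Commute (u : 𝒜) a :=
  (Unitary.toUnits u).mul_inv_eq_iff_eq_mul

instance compactSpace_unitary [FiniteDimensional ℂ 𝒜] : CompactSpace (unitary 𝒜) := by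
  have norm_le_one (u : 𝒜) (hu : u ∈ unitary 𝒜) : ‖u‖ ≤ 1 := by
    nontriviality 𝒜
    exact (CStarRing.norm_of_mem_unitary hu).le
  have := FiniteDimensional.proper ℂ 𝒜
  exact isCompact_iff_compactSpace.1 <| Metric.isCompact_of_isClosed_isBounded isClosed_unitary <|
    isBounded_iff_forall_norm_le.2 ⟨1, norm_le_one⟩

theorem commute_apply_of_forall_commute_unitaryConj {R : 𝒜 →L[ℂ] 𝒜}
    (hR : ∀ u, Commute (unitaryConj u) R) {a s : 𝒜} (hs : Commute s a) (hs' : Commute s (star a)) :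
    Commute s (R a) := by
  let S := StarSubalgebra.centralizer ℂ {a}
  have : IsClosed (S : Set 𝒜) := by
    rw [StarSubalgebra.coe_centralizer]
    exact Set.isClosed_centralizer _
  have mem_S {t : 𝒜} : t ∈ S ↔ Commute t a ∧ Commute t (star a) := by
    simp [S, StarSubalgebra.mem_centralizer_iff, commute_iff_eq, eq_comm]
  have commute_of_unitary (u : S) (hu : u ∈ unitary S) : Commute (u : 𝒜) (R a) := by
    let v : unitary 𝒜 := ⟨(u : 𝒜), Unitary.map_mem S.subtype hu⟩
    have hva : unitaryConj v a = a := unitaryConj_apply_eq_self_iff.2 (mem_S.1 u.2).1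
    have hvR := DFunLike.congr_fun (hR v).eq a
    rw [mul_apply_eq_comp, mul_apply_eq_comp, hva] at hvR
    exact unitaryConj_apply_eq_self_iff.1 hvR
  have s_mem_span : (⟨s, mem_S.2 ⟨hs, hs'⟩⟩ : S) ∈ Submodule.span ℂ (unitary S : Set S) :=
    CStarAlgebra.span_unitary S ▸ Submodule.mem_top
  suffices ∀ t ∈ Submodule.span ℂ (unitary S : Set S), Commute (t : 𝒜) (R a) from
    this _ s_mem_span
  intro t ht
  induction ht using Submodule.span_induction with
  | mem u hu => exact commute_of_unitary u hu
  | zero => exact Commute.zero_left _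
  | add t₁ t₂ _ _ h₁ h₂ => exact h₁.add_left h₂
  | smul c t _ h => exact h.smul_left c

end UnitaryConj

section Equivariant

open ContinuousLinearMap InnerProductSpace Module

variable {X : Type*} [NormedAddCommGroup X] [InnerProductSpace ℂ X]

theorem exists_apply_eq_smul_of_commute_rankOne_self {x : X} {T : X →L[ℂ] X}
    (hT : ∀ S, Commute S (rankOne ℂ x x) → Commute S T) :
    ∃ b : ℂ, ∀ v : X, inner ℂ x v = 0 → T v = b • v := by
  by_cases! h : ∀ w : X, inner ℂ x w = 0 → w = 0
  · exact ⟨0, fun v hv ↦ by simp [h v hv]⟩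
  obtain ⟨w, hxw, hw⟩ := h
  have hww : inner ℂ w w ≠ 0 := inner_self_ne_zero.2 hw
  refine ⟨inner ℂ w (T w) / inner ℂ w w, fun v hxv ↦ ?_⟩
  have commute_rankOne : Commute (rankOne ℂ v w) (rankOne ℂ x x) := by
    ext z
    simp [mul_apply_eq_comp, hxv, inner_eq_zero_symm.1 hxw]
  have hTv : inner ℂ w (T w) • v = inner ℂ w w • T v := by
    simpa [mul_apply_eq_comp] using DFunLike.congr_fun (hT _ commute_rankOne).eq w
  rw [div_eq_inv_mul, mul_smul, hTv, inv_smul_smul₀ hww]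

theorem exists_eq_smul_rankOne_self_add_smul_one {x : X} (hx : ‖x‖ = 1) {T : X →L[ℂ] X}
    (hT : ∀ S, Commute S (rankOne ℂ x x) → Commute S T) :
    ∃ a b : ℂ, T = a • rankOne ℂ x x + b • 1 := by
  obtain ⟨b, hb⟩ := exists_apply_eq_smul_of_commute_rankOne_self hT
  have hTx : inner ℂ x (T x) • x = T x := by
    simpa [mul_apply_eq_comp, hx] using DFunLike.congr_fun (hT _ (Commute.refl _)).eq x
  refine ⟨inner ℂ x (T x) - b, b, ext fun z ↦ ?_⟩
  have hTz := hb (z - inner ℂ x z • x) (by simp [hx])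
  rw [map_sub, map_smul, ← hTx, sub_eq_iff_eq_add] at hTz
  rw [hTz]
  simp only [add_apply, smul_apply, rankOne_apply, one_apply_eq_self]
  module

theorem unitaryConj_rankOne [CompleteSpace X] (u : unitary (X →L[ℂ] X)) (x y : X) :
    unitaryConj u (rankOne ℂ x y) = rankOne ℂ ((u : X →L[ℂ] X) x) ((u : X →L[ℂ] X) y) := by
  rw [unitaryConj_apply, star_eq_adjoint, mul_def, mul_def, comp_rankOne, rankOne_comp,
    adjoint_adjoint]

theorem sum_rankOne_apply {ι : Type*} [Fintype ι] (b : OrthonormalBasis ι ℂ X) (A : X →L[ℂ] X) :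
    ∑ i, rankOne ℂ (A (b i)) (b i) = A := by
  simp only [← comp_rankOne, ← comp_finsetSum, b.sum_rankOne_eq_id, comp_id]

variable [FiniteDimensional ℂ X]

theorem exists_linearIsometryEquiv_apply_eq {x y : X} (hx : ‖x‖ = 1) (hy : ‖y‖ = 1) :
    ∃ e : X ≃ₗᵢ[ℂ] X, e x = y := by
  let toSpan (z : X) (hz : ‖z‖ = 1) := LinearIsometryEquiv.toSpanUnitSingleton (𝕜 := ℂ) z hz
  let f : (ℂ ∙ x) →ₗᵢ[ℂ] X := (ℂ ∙ y).subtypeₗᵢ.comp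
    ((toSpan x hx).symm.trans (toSpan y hy)).toLinearIsometry
  refine ⟨f.extend.toLinearIsometryEquiv rfl, ?_⟩
  have hx_mem : x ∈ ℂ ∙ x := Submodule.mem_span_singleton_self x
  have symm_apply : (toSpan x hx).symm ⟨x, hx_mem⟩ = 1 := by
    rw [LinearIsometryEquiv.symm_apply_eq]
    simp [toSpan]
  simpa [f, symm_apply, toSpan] using f.extend_apply ⟨x, hx_mem⟩

theorem eq_zero_of_forall_rankOne_self {V : Type*} [AddCommGroup V] [Module ℂ V]
    {S : (X →L[ℂ] X) →ₗ[ℂ] V} (h : ∀ x : X, ‖x‖ = 1 → S (rankOne ℂ x x) = 0) : S = 0 := by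
  have apply_self (x : X) : S (rankOne ℂ x x) = 0 := by
    obtain rfl | hx := eq_or_ne x 0
    · simp
    simpa [hx] using h (((‖x‖ : ℝ) : ℂ)⁻¹ • x) (by simp [norm_smul, hx])
  have apply_rankOne (x y : X) : S (rankOne ℂ x y) = 0 := by
    have h_add := apply_self (x + y)
    have h_I := apply_self (x + Complex.I • y)
    simp only [map_add, add_apply, map_smul, map_smulₛₗ, smul_apply, Complex.conj_I, apply_self,
      smul_zero, zero_add, add_zero] at h_add h_I
    have two_I_smul : (2 * Complex.I) • S (rankOne ℂ x y) = 0 := by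
      linear_combination (norm := module) Complex.I • h_add - h_I
    simpa using two_I_smul
  ext A
  rw [← sum_rankOne_apply (stdOrthonormalBasis ℂ X) A, map_sum]
  simp [apply_rankOne]

theorem exists_eq_smul_one_add_smul_smulRight [CompleteSpace X]
    {R : (X →L[ℂ] X) →L[ℂ] (X →L[ℂ] X)} (hR : ∀ u, Commute (unitaryConj u) R) :
    ∃ s t : ℂ, R = s • 1 + t • (traceCLM X).smulRight 1 := by
  obtain _ | _ := subsingleton_or_nontrivial X
  · exact ⟨0, 0, Subsingleton.elim _ _⟩
  obtain ⟨x, hx⟩ := exists_norm_eq X zero_le_one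
  have star_rankOne : star (rankOne ℂ x x) = rankOne ℂ x x := by
    rw [star_eq_adjoint, adjoint_rankOne]
  obtain ⟨s, t, hst⟩ := exists_eq_smul_rankOne_self_add_smul_one hx fun S hS ↦
    commute_apply_of_forall_commute_unitaryConj hR hS (star_rankOne.symm ▸ hS)
  refine ⟨s, t, ?_⟩
  have toLinearMap_sub_eq_zero : (R - (s • 1 + t • (traceCLM X).smulRight 1)).toLinearMap = 0 := by
    refine eq_zero_of_forall_rankOne_self fun y hy ↦ ?_
    obtain ⟨e, rfl⟩ := exists_linearIsometryEquiv_apply_eq hx hy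
    let u := Unitary.linearIsometryEquiv.symm e
    have conj_rankOne : unitaryConj u (rankOne ℂ x x) = rankOne ℂ (e x) (e x) :=
      unitaryConj_rankOne u x x
    have apply_rankOne : R (rankOne ℂ (e x) (e x)) = unitaryConj u (R (rankOne ℂ x x)) := by
      rw [← conj_rankOne]
      exact (DFunLike.congr_fun (hR u).eq _).symm
    have trace_rankOne_self : traceCLM X (rankOne ℂ (e x) (e x)) = 1 :=
      (trace_rankOne _ _).trans (inner_self_eq_one_of_norm_eq_one hy)
    rw [hst, map_add, map_smul, map_smul, conj_rankOne, unitaryConj_apply_one] at apply_rankOne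
    simp [apply_rankOne, trace_rankOne_self]
  exact sub_eq_zero.1 (coe_injective toLinearMap_sub_eq_zero)

end Equivariant

section UnitaryTwirl

open MeasureTheory Module

variable {X : Type*} [NormedAddCommGroup X] [InnerProductSpace ℂ X] [FiniteDimensional ℂ X]
  [CompleteSpace X] (μ : Measure (unitary (X →L[ℂ] X))) [IsProbabilityMeasure μ]

omit [CompleteSpace X] in
theorem finrank_continuousLinearMap_self :
    finrank ℂ (X →L[ℂ] X) = finrank ℂ X ^ 2 := by
  rw [← LinearMap.toContinuousLinearMap.finrank_eq, finrank_linearMap, sq]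

theorem traceCLM_unitaryConj_apply (u : unitary (X →L[ℂ] X)) (A : X →L[ℂ] X) :
    traceCLM X (unitaryConj u A) = traceCLM X A :=
  traceCLM_mul_mul_of_mul_eq_one (Unitary.coe_star_mul_self u) A

theorem traceCLM_twirl_unitaryConj_apply_one (K : (X →L[ℂ] X) →L[ℂ] (X →L[ℂ] X)) :
    traceCLM X (twirl μ unitaryConj K 1) = traceCLM X (K 1) := by
  have trace_conj (u : unitary (X →L[ℂ] X)) :
      traceCLM X ((unitaryConj u * K * unitaryConj u⁻¹) 1) = traceCLM X (K 1) := by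
    simp only [mul_apply_eq_comp, unitaryConj_apply_one, traceCLM_unitaryConj_apply]
  calc traceCLM X (twirl μ unitaryConj K 1)
      = ∫ u, traceCLM X ((unitaryConj u * K * unitaryConj u⁻¹) 1) ∂μ :=
        map_twirl μ continuous_unitaryConj
          (traceCLM X ∘L ContinuousLinearMap.apply ℂ (X →L[ℂ] X) 1) K
    _ = traceCLM X (K 1) := by simp only [trace_conj, integral_const, probReal_univ, one_smul]

variable [μ.IsMulLeftInvariant]

theorem smul_twirl_unitaryConj_apply (K : (X →L[ℂ] X) →L[ℂ] (X →L[ℂ] X)) (A : X →L[ℂ] X) :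
    ((finrank ℂ X : ℂ) * ((finrank ℂ X : ℂ) ^ 2 - 1)) • twirl μ unitaryConj K A =
      (finrank ℂ X * traceCLM (X →L[ℂ] X) K - traceCLM X (K 1)) • A +
        ((finrank ℂ X * traceCLM X (K 1) - traceCLM (X →L[ℂ] X) K) * traceCLM X A) • 1 := by
  obtain ⟨s, t, hst⟩ := exists_eq_smul_one_add_smul_smulRight
    fun u ↦ commute_twirl μ continuous_unitaryConj u K
  have trace_eq : traceCLM (X →L[ℂ] X) K = s * finrank ℂ X ^ 2 + t * finrank ℂ X := by
    rw [← traceCLM_twirl μ continuous_unitaryConj, hst]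
    simp [traceCLM_one, traceCLM_smulRight, finrank_continuousLinearMap_self]
  have trace_apply_one : traceCLM X (K 1) = s * finrank ℂ X + t * finrank ℂ X ^ 2 := by
    rw [← traceCLM_twirl_unitaryConj_apply_one μ, hst]
    simp [traceCLM_one, sq]
  rw [hst, trace_eq, trace_apply_one]
  simp only [add_apply, smul_apply, one_apply_eq_self, ContinuousLinearMap.smulRight_apply]
  module

theorem smul_integral_traceCLM_smul_unitaryConj_apply (T : (X →L[ℂ] X) →L[ℂ] (X →L[ℂ] X))
    (A : X →L[ℂ] X) :
    ((finrank ℂ X : ℂ) * ((finrank ℂ X : ℂ) ^ 2 - 1)) •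
        (∫ u, traceCLM (X →L[ℂ] X) (unitaryConj u⁻¹ * T) • unitaryConj u ∂μ) A =
      (finrank ℂ X : ℂ) • T A - traceCLM X A • T 1 +
        (finrank ℂ X * traceCLM X A * traceCLM X (T 1) - traceCLM X (T A)) • 1 := by
  let b := finBasis ℂ (X →L[ℂ] X)
  have sum_coord (B : X →L[ℂ] X) : ∑ k, b.coord k B • T (b k) = T B := by
    simp only [← map_smul, ← map_sum, Basis.coord_apply, b.sum_repr]
  have sum_coord_mul (B : X →L[ℂ] X) :
      ∑ k, b.coord k B * traceCLM X (T (b k)) = traceCLM X (T B) := by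
    simp only [← sum_coord B, map_sum, map_smul, smul_eq_mul]
  rw [integral_traceCLM_smul_apply μ continuous_unitaryConj b, Finset.smul_sum]
  calc ∑ k, ((finrank ℂ X : ℂ) * ((finrank ℂ X : ℂ) ^ 2 - 1)) •
        twirl μ unitaryConj ((b.coord k).toContinuousLinearMap.smulRight A) (T (b k))
      = ∑ k, ((finrank ℂ X : ℂ) • (b.coord k A • T (b k)) -
          traceCLM X A • (b.coord k 1 • T (b k)) +
          (finrank ℂ X * traceCLM X A * (b.coord k 1 * traceCLM X (T (b k))) -
            b.coord k A * traceCLM X (T (b k))) • 1) := by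
        refine Finset.sum_congr rfl fun k _ ↦ ?_
        rw [smul_twirl_unitaryConj_apply, traceCLM_smulRight, ContinuousLinearMap.smulRight_apply,
          map_smul, LinearMap.coe_toContinuousLinearMap', smul_eq_mul]
        module
    _ = _ := by
        simp only [Finset.sum_add_distrib, Finset.sum_sub_distrib, ← Finset.smul_sum,
          ← Finset.sum_smul, ← Finset.mul_sum, sum_coord, sum_coord_mul]

end UnitaryTwirl

section ConvexHull

open MeasureTheory

theorem image_stdSimplex_eq_convexHull_range {ι E : Type*} [Fintype ι] [AddCommGroup E]
    [Module ℝ E] (f : ι → E) :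
    Fintype.linearCombination ℝ f '' stdSimplex ℝ ι = convexHull ℝ (Set.range f) := by
  classical
  rw [← convexHull_rangle_single_eq_stdSimplex, LinearMap.image_convexHull, ← Set.range_comp]
  congr 2
  ext i
  simp

variable {E : Type*} [NormedAddCommGroup E] [NormedSpace ℝ E] [FiniteDimensional ℝ E]

theorem exists_range_subset_mem_convexHull_range {s : Set E} {x : E} (hx : x ∈ convexHull ℝ s) :
    ∃ f : Fin (Module.finrank ℝ E + 1) → E, Set.range f ⊆ s ∧ x ∈ convexHull ℝ (Set.range f) := by
  rw [convexHull_eq_union] at hx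
  simp only [Set.mem_iUnion] at hx
  obtain ⟨t, hts, ht, hxt⟩ := hx
  have : Nonempty t := (convexHull_nonempty_iff.1 ⟨x, hxt⟩).to_subtype
  obtain ⟨e⟩ : Nonempty (t ↪ Fin (Module.finrank ℝ E + 1)) :=
    Function.Embedding.nonempty_of_card_le <| by
      simpa using ht.card_le_finrank_succ.trans (Nat.succ_le_succ (Submodule.finrank_le _))
  obtain ⟨g, hg⟩ : ∃ g : Fin (Module.finrank ℝ E + 1) → t, g.Surjective :=
    ⟨_, Function.invFun_surjective e.injective⟩
  have range_eq : Set.range (fun i ↦ (g i : E)) = t := by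
    rw [Set.range_comp' Subtype.val, hg.range_eq]
    simp
  exact ⟨_, range_eq.trans_subset hts, range_eq.symm ▸ hxt⟩

theorem isCompact_convexHull {s : Set E} (hs : IsCompact s) : IsCompact (convexHull ℝ s) := by
  let ι := Fin (Module.finrank ℝ E + 1)
  let combine (q : (ι → ℝ) × (ι → E)) : E := Fintype.linearCombination ℝ q.2 q.1
  have convexHull_eq : convexHull ℝ s = combine '' (stdSimplex ℝ ι ×ˢ Set.univ.pi fun _ ↦ s) := by
    ext x
    constructor
    · intro hx
      obtain ⟨f, hfs, hxf⟩ := exists_range_subset_mem_convexHull_range hx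
      rw [← image_stdSimplex_eq_convexHull_range] at hxf
      obtain ⟨w, hw, rfl⟩ := hxf
      exact ⟨(w, f), ⟨hw, fun i _ ↦ hfs (Set.mem_range_self i)⟩, rfl⟩
    · rintro ⟨⟨w, f⟩, ⟨hw, hf⟩, rfl⟩
      have hfs : Set.range f ⊆ s := Set.range_subset_iff.2 fun i ↦ hf i (Set.mem_univ i)
      refine convexHull_mono hfs ?_
      rw [← image_stdSimplex_eq_convexHull_range]
      exact Set.mem_image_of_mem _ hw
  rw [convexHull_eq]
  refine ((isCompact_stdSimplex ℝ ι).prod (isCompact_univ_pi fun _ ↦ hs)).image ?_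
  simp only [combine, Fintype.linearCombination_apply]
  fun_prop

theorem integral_smul_mem_convexHull_range {G : Type*} [TopologicalSpace G] [CompactSpace G]
    [MeasurableSpace G] [BorelSpace G] {μ : Measure G} [IsFiniteMeasure μ] {w : G → NNReal}
    (hw : Continuous w) (hw1 : ∫ g, (w g : ℝ) ∂μ = 1) {f : G → E} (hf : Continuous f) :
    ∫ g, w g • f g ∂μ ∈ convexHull ℝ (Set.range f) := by
  have isProbabilityMeasure_withDensity :
      IsProbabilityMeasure (μ.withDensity fun g ↦ (w g : ENNReal)) := by
    constructor
    rw [withDensity_apply _ MeasurableSet.univ, Measure.restrict_univ, lintegral_coe_eq_integral _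
      (integrable_of_continuous_of_compactSpace (by fun_prop)), hw1, ENNReal.ofReal_one]
  rw [← integral_withDensity_eq_integral_smul hw.measurable]
  exact (convex_convexHull ℝ _).integral_mem
    (isCompact_convexHull (isCompact_range hf)).isClosed
    (Filter.Eventually.of_forall fun g ↦ subset_convexHull ℝ _ (Set.mem_range_self g))
    (integrable_of_continuous_of_compactSpace hf)

end ConvexHull

section CompletelyPositive

open ContinuousLinearMap InnerProductSpace
open scoped ComplexOrder

theorem cstarMatrix_star_mul_nonneg {𝒜 ι : Type*} [CStarAlgebra 𝒜] [PartialOrder 𝒜]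
    [StarOrderedRing 𝒜] [Fintype ι] (a : ι → 𝒜) :
    0 ≤ CStarMatrix.ofMatrix (Matrix.of fun i j ↦ star (a i) * a j) := by
  classical
  obtain _ | ⟨⟨i₀⟩⟩ := isEmpty_or_nonempty ι
  · exact (CStarMatrix.ext fun i ↦ isEmptyElim i).le
  let row : CStarMatrix ι ι 𝒜 :=
    CStarMatrix.ofMatrix (Matrix.of fun i j ↦ if i = i₀ then a j else 0)
  have eq_star_mul_self :
      CStarMatrix.ofMatrix (Matrix.of fun i j ↦ star (a i) * a j) = star row * row := by
    ext i j : 2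
    simp [row, CStarMatrix.mul_apply, CStarMatrix.star_apply, apply_ite star]
  exact eq_star_mul_self ▸ star_mul_self_nonneg row

variable {X : Type*} [NormedAddCommGroup X] [InnerProductSpace ℂ X]

section Complete

variable [CompleteSpace X] {ι : Type*} [Fintype ι]

theorem sum_inner_cstarMatrix_nonneg {P : CStarMatrix ι ι (X →L[ℂ] X)} (hP : 0 ≤ P) (x : ι → X) :
    0 ≤ ∑ i, ∑ j, inner ℂ (x i) (P i j (x j)) := by
  rw [StarOrderedRing.nonneg_iff] at hP
  induction hP using AddSubmonoid.closure_induction with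
  | mem _ h =>
    obtain ⟨N, rfl⟩ := h
    calc 0 ≤ ∑ k, inner ℂ (∑ i, N k i (x i)) (∑ j, N k j (x j)) :=
          Finset.sum_nonneg fun k _ ↦ by
            rw [inner_self_eq_norm_sq_to_K]
            exact pow_nonneg (RCLike.ofReal_nonneg.2 (norm_nonneg _)) 2
      _ = ∑ k, ∑ i, ∑ j, inner ℂ (N k i (x i)) (N k j (x j)) := by
          simp_rw [sum_inner, inner_sum]
      _ = ∑ i, ∑ j, ∑ k, inner ℂ (N k i (x i)) (N k j (x j)) := by
          rw [Finset.sum_comm]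
          exact Finset.sum_congr rfl fun i _ ↦ Finset.sum_comm
      _ = ∑ i, ∑ j, inner ℂ (x i) ((star N * N) i j (x j)) := by
          simp [CStarMatrix.mul_apply, CStarMatrix.star_apply, sum_apply, mul_apply_eq_comp,
            star_eq_adjoint, adjoint_inner_right]
  | zero => simp
  | add P Q _ _ hP hQ =>
    simpa [inner_add_right, Finset.sum_add_distrib] using add_nonneg hP hQ

theorem IsCompletelyPositive.sum_inner_apply_star_mul_nonneg {Y : Type*} [NormedAddCommGroup Y]
    [InnerProductSpace ℂ Y] [CompleteSpace Y] {Φ : (X →L[ℂ] X) →ₗ[ℂ] (Y →L[ℂ] Y)}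
    (hΦ : IsCompletelyPositive Φ) (a : ι → (X →L[ℂ] X)) (y : ι → Y) :
    0 ≤ ∑ i, ∑ j, inner ℂ (y i) (Φ (star (a i) * a j) (y j)) := by
  obtain ⟨F, rfl⟩ := hΦ
  exact sum_inner_cstarMatrix_nonneg (F.map_cstarMatrix_nonneg _ (cstarMatrix_star_mul_nonneg a)) y

end Complete

theorem traceCLM_eq_sum_inner_apply_rankOne [FiniteDimensional ℂ X] {ι : Type*} [Fintype ι]
    (b : OrthonormalBasis ι ℂ X) (T : (X →L[ℂ] X) →L[ℂ] (X →L[ℂ] X)) :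
    traceCLM (X →L[ℂ] X) T = ∑ i, ∑ j, inner ℂ (b i) (T (rankOne ℂ (b i) (b j)) (b j)) := by
  let entry (i j : ι) : (X →L[ℂ] X) →L[ℂ] ℂ := innerSL ℂ (b i) ∘L apply ℂ X (b j)
  have sum_entry (A : X →L[ℂ] X) : ∑ i, ∑ j, entry i j A • rankOne ℂ (b i) (b j) = A := by
    rw [Finset.sum_comm]
    conv_rhs => rw [← sum_rankOne_apply b A]
    refine Finset.sum_congr rfl fun j _ ↦ ?_
    conv_rhs => rw [← b.sum_repr' (A (b j))]
    simp [entry]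
  have sum_smulRight : T = ∑ i, ∑ j, (entry i j).smulRight (T (rankOne ℂ (b i) (b j))) := by
    ext1 A
    conv_lhs => rw [← sum_entry A]
    simp [sum_apply]
  conv_lhs => rw [sum_smulRight]
  simp [traceCLM_smulRight, entry]

variable [FiniteDimensional ℂ X] [CompleteSpace X]

theorem IsCompletelyPositive.traceCLM_nonneg {Φ : (X →L[ℂ] X) →ₗ[ℂ] (X →L[ℂ] X)}
    (hΦ : IsCompletelyPositive Φ) :
    0 ≤ traceCLM (X →L[ℂ] X) Φ.toContinuousLinearMap := by
  obtain _ | _ := subsingleton_or_nontrivial X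
  · simp [Subsingleton.elim Φ.toContinuousLinearMap 0]
  obtain ⟨x, hx⟩ := exists_norm_eq X zero_le_one
  let b := stdOrthonormalBasis ℂ X
  have rankOne_eq (i j) : rankOne ℂ (b i) (b j) = star (rankOne ℂ x (b i)) * rankOne ℂ x (b j) := by
    simp [star_eq_adjoint, mul_def, comp_rankOne, hx]
  rw [traceCLM_eq_sum_inner_apply_rankOne b]
  simp only [rankOne_eq]
  exact hΦ.sum_inner_apply_star_mul_nonneg (fun i ↦ rankOne ℂ x (b i)) b

end CompletelyPositive

section UnitaryChannel

open ContinuousLinearMap LinearIsometryEquiv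

variable {X Y Z : Type*}
  [NormedAddCommGroup X] [InnerProductSpace ℂ X] [CompleteSpace X]
  [NormedAddCommGroup Y] [InnerProductSpace ℂ Y] [CompleteSpace Y]
  [NormedAddCommGroup Z] [InnerProductSpace ℂ Z] [CompleteSpace Z]

/-- The unitary channel `A ↦ U A U⋆` of a unitary map `U : X → Y`; mixed-unitary channels are the
convex combinations of these. -/
noncomputable def unitaryChannel (U : X ≃ₗᵢ[ℂ] Y) : (X →L[ℂ] X) →ₗ[ℂ] (Y →L[ℂ] Y) :=
  U.conjStarAlgEquiv.toAlgEquiv.toLinearMap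

theorem unitaryChannel_apply (U : X ≃ₗᵢ[ℂ] Y) (A : X →L[ℂ] X) :
    unitaryChannel U A = U.conjStarAlgEquiv A := rfl

theorem unitaryChannel_apply_one (U : X ≃ₗᵢ[ℂ] Y) : unitaryChannel U 1 = 1 :=
  map_one U.conjStarAlgEquiv

theorem unitaryChannel_comp_symm_comp {M : Type*} [AddCommMonoid M] [Module ℂ M]
    (U : X ≃ₗᵢ[ℂ] Y) (Φ : M →ₗ[ℂ] (Y →L[ℂ] Y)) :
    unitaryChannel U ∘ₗ unitaryChannel U.symm ∘ₗ Φ = Φ := by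
  ext1 m
  exact U.conjStarAlgEquiv.apply_symm_apply (Φ m)

theorem unitaryChannel_linearIsometryEquiv (u : unitary (X →L[ℂ] X)) :
    unitaryChannel (Unitary.linearIsometryEquiv u) = (unitaryConj u : (X →L[ℂ] X) →ₗ[ℂ] _) := rfl

theorem isTracePreserving_unitaryChannel (U : X ≃ₗᵢ[ℂ] Y) :
    IsTracePreserving (unitaryChannel U) := fun A ↦
  LinearMap.trace_conj' (A : X →ₗ[ℂ] X) U.toLinearEquiv

theorem IsCompletelyPositive.unitaryChannel_comp {Φ : (X →L[ℂ] X) →ₗ[ℂ] (Y →L[ℂ] Y)}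
    (hΦ : IsCompletelyPositive Φ) (U : Y ≃ₗᵢ[ℂ] Z) :
    IsCompletelyPositive (unitaryChannel U ∘ₗ Φ) := by
  obtain ⟨F, rfl⟩ := hΦ
  refine ⟨⟨unitaryChannel U ∘ₗ F.toLinearMap, fun k M hM ↦ ?_⟩, rfl⟩
  exact CompletelyPositiveMapClass.map_cstarMatrix_nonneg' U.conjStarAlgEquiv k _
    (F.map_cstarMatrix_nonneg' k M hM)

theorem IsDoublyStochastic.unitaryChannel_comp {Φ : (X →L[ℂ] X) →ₗ[ℂ] (Y →L[ℂ] Y)}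
    (hΦ : IsDoublyStochastic Φ) (U : Y ≃ₗᵢ[ℂ] Z) :
    IsDoublyStochastic (unitaryChannel U ∘ₗ Φ) where
  completelyPositive := hΦ.completelyPositive.unitaryChannel_comp U
  tracePreserving A :=
    (isTracePreserving_unitaryChannel U (Φ A)).trans (hΦ.tracePreserving A)
  unital := by rw [LinearMap.comp_apply, hΦ.unital, unitaryChannel_apply_one]

theorem isMixedUnitary_iff_mem_convexHull {Φ : (X →L[ℂ] X) →ₗ[ℂ] (Y →L[ℂ] Y)} :
    IsMixedUnitary Φ ↔
      Φ ∈ convexHull ℝ (Set.range (unitaryChannel : (X ≃ₗᵢ[ℂ] Y) → _)) := by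
  constructor
  · rintro ⟨N, q, U, hq, hq1, hΦ⟩
    have eq_sum : Φ = ∑ i, q i • unitaryChannel (U i) := by
      ext1 A
      simp [hΦ, unitaryChannel_apply, conjStarAlgEquiv_apply, adjoint_eq_symm]
    rw [eq_sum]
    exact (convex_convexHull ℝ _).sum_mem (fun i _ ↦ hq i) hq1
      fun i _ ↦ subset_convexHull ℝ _ (Set.mem_range_self (U i))
  · intro h
    obtain ⟨κ, _, q, z, hq, hq1, hz, rfl⟩ := mem_convexHull_iff_exists_fintype.1 h
    choose U hU using hz
    let e := (Fintype.equivFin κ).symm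
    refine ⟨Fintype.card κ, q ∘ e, U ∘ e, fun i ↦ hq _, ?_, fun A ↦ ?_⟩
    · rw [← hq1]
      exact e.sum_comp q
    · rw [LinearMap.sum_apply, ← e.sum_comp]
      simp [← hU, unitaryChannel_apply, conjStarAlgEquiv_apply, adjoint_eq_symm]

theorem isMixedUnitary_unitaryChannel (U : X ≃ₗᵢ[ℂ] Y) : IsMixedUnitary (unitaryChannel U) :=
  isMixedUnitary_iff_mem_convexHull.2 (subset_convexHull ℝ _ (Set.mem_range_self U))

theorem IsMixedUnitary.unitaryChannel_comp {Φ : (X →L[ℂ] X) →ₗ[ℂ] (Y →L[ℂ] Y)}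
    (hΦ : IsMixedUnitary Φ) (U : Y ≃ₗᵢ[ℂ] Z) : IsMixedUnitary (unitaryChannel U ∘ₗ Φ) := by
  let L : ((X →L[ℂ] X) →ₗ[ℂ] (Y →L[ℂ] Y)) →ₗ[ℝ] ((X →L[ℂ] X) →ₗ[ℂ] (Z →L[ℂ] Z)) :=
    (LinearMap.compRight ℂ (unitaryChannel U)).restrictScalars ℝ
  rw [isMixedUnitary_iff_mem_convexHull] at hΦ ⊢
  have mem_image := Set.mem_image_of_mem L hΦ
  rw [LinearMap.image_convexHull, ← Set.range_comp] at mem_image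
  refine convexHull_mono ?_ mem_image
  rintro _ ⟨V, rfl⟩
  exact ⟨V.trans U, rfl⟩

theorem isMixedUnitary_of_mem_convexHull_range_unitaryConj {K : (X →L[ℂ] X) →L[ℂ] (X →L[ℂ] X)}
    (hK : K ∈ convexHull ℝ (Set.range unitaryConj)) :
    IsMixedUnitary (K : (X →L[ℂ] X) →ₗ[ℂ] (X →L[ℂ] X)) := by
  let L : ((X →L[ℂ] X) →L[ℂ] (X →L[ℂ] X)) →ₗ[ℝ] ((X →L[ℂ] X) →ₗ[ℂ] (X →L[ℂ] X)) :=
    (ContinuousLinearMap.coeLM ℂ).restrictScalars ℝ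
  have mem_image := Set.mem_image_of_mem L hK
  rw [LinearMap.image_convexHull, ← Set.range_comp] at mem_image
  refine isMixedUnitary_iff_mem_convexHull.2 (convexHull_mono ?_ mem_image)
  rintro _ ⟨u, rfl⟩
  exact ⟨Unitary.linearIsometryEquiv u, unitaryChannel_linearIsometryEquiv u⟩

theorem IsMixedUnitary.smul_add_one_sub_smul {Φ Ψ : (X →L[ℂ] X) →ₗ[ℂ] (Y →L[ℂ] Y)}
    (hΦ : IsMixedUnitary Φ) (hΨ : IsMixedUnitary Ψ) {s : ℝ} (hs0 : 0 ≤ s) (hs1 : s ≤ 1) :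
    IsMixedUnitary (s • Φ + (1 - s) • Ψ) := by
  rw [isMixedUnitary_iff_mem_convexHull] at *
  exact convex_convexHull ℝ _ hΦ hΨ hs0 (sub_nonneg.2 hs1) (add_sub_cancel _ _)

end UnitaryChannel

section Depolarizing

open Module ContinuousLinearMap MeasureTheory
open scoped ComplexOrder

variable {X : Type*} [NormedAddCommGroup X] [InnerProductSpace ℂ X] [FiniteDimensional ℂ X]

section Basic

variable {Y : Type*} [NormedAddCommGroup Y] [InnerProductSpace ℂ Y] [FiniteDimensional ℂ Y]

omit [FiniteDimensional ℂ Y] in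
theorem completelyDepolarizing_apply (A : X →L[ℂ] X) :
    completelyDepolarizing X Y A = (traceCLM X A / (finrank ℂ Y : ℂ)) • 1 := rfl

theorem completelyDepolarizing_apply_one (hXY : finrank ℂ X = finrank ℂ Y) :
    completelyDepolarizing X Y 1 = 1 := by
  obtain hY | hY := eq_or_ne (finrank ℂ Y) 0
  · have : Subsingleton Y := finrank_zero_iff.1 hY
    exact Subsingleton.elim _ _
  · rw [completelyDepolarizing_apply, traceCLM_one, hXY, div_self (Nat.cast_ne_zero.2 hY), one_smul]

theorem isTracePreserving_completelyDepolarizing [Nontrivial Y] :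
    IsTracePreserving (completelyDepolarizing X Y) := by
  intro A
  rw [← traceCLM_apply, ← traceCLM_apply, completelyDepolarizing_apply, map_smul, traceCLM_one,
    smul_eq_mul, div_mul_cancel₀ _ (Nat.cast_ne_zero.2 finrank_pos.ne')]

omit [FiniteDimensional ℂ Y] in
theorem unitaryChannel_comp_completelyDepolarizing [CompleteSpace X] [CompleteSpace Y]
    (U : X ≃ₗᵢ[ℂ] Y) :
    unitaryChannel U ∘ₗ completelyDepolarizing X X = completelyDepolarizing X Y := by
  ext1 A
  rw [LinearMap.comp_apply, completelyDepolarizing_apply, completelyDepolarizing_apply, map_smul,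
    unitaryChannel_apply_one, U.toLinearEquiv.finrank_eq]

end Basic

theorem exists_eq_smul_one_of_finrank_le_one (hX : finrank ℂ X ≤ 1) (A : X →L[ℂ] X) :
    ∃ c : ℂ, A = c • 1 := by
  obtain ⟨v, hv⟩ := finrank_le_one_iff.1 hX
  obtain ⟨c, hc⟩ := hv (A v)
  refine ⟨c, ContinuousLinearMap.ext fun w ↦ ?_⟩
  obtain ⟨k, rfl⟩ := hv w
  rw [map_smul, ← hc, smul_apply, one_apply_eq_self, smul_comm]

theorem eq_of_apply_one_eq_of_finrank_le_one (hX : finrank ℂ X ≤ 1) {M : Type*} [AddCommMonoid M]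
    [Module ℂ M] {Φ Ψ : (X →L[ℂ] X) →ₗ[ℂ] M} (h : Φ 1 = Ψ 1) : Φ = Ψ := by
  ext1 A
  obtain ⟨c, rfl⟩ := exists_eq_smul_one_of_finrank_le_one hX A
  rw [map_smul, map_smul, h]

variable [CompleteSpace X]

theorem IsCompletelyPositive.traceCLM_unitaryConj_mul_nonneg {Φ : (X →L[ℂ] X) →ₗ[ℂ] (X →L[ℂ] X)}
    (hΦ : IsCompletelyPositive Φ) (u : unitary (X →L[ℂ] X)) :
    0 ≤ traceCLM (X →L[ℂ] X) (unitaryConj u * Φ.toContinuousLinearMap) :=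
  (hΦ.unitaryChannel_comp (Unitary.linearIsometryEquiv u)).traceCLM_nonneg

theorem traceCLM_unitaryConj_mul_completelyDepolarizing [Nontrivial X]
    (u : unitary (X →L[ℂ] X)) :
    traceCLM (X →L[ℂ] X)
      (unitaryConj u * (completelyDepolarizing X X).toContinuousLinearMap) = 1 := by
  have mul_eq : unitaryConj u * (completelyDepolarizing X X).toContinuousLinearMap =
      (traceCLM X).smulRight ((finrank ℂ X : ℂ)⁻¹ • (1 : X →L[ℂ] X)) := by
    ext1 A
    simp only [mul_apply_eq_comp, LinearMap.coe_toContinuousLinearMap', map_smul, smul_smul,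
      completelyDepolarizing_apply, unitaryConj_apply_one, ContinuousLinearMap.smulRight_apply,
      div_eq_mul_inv]
  have : (finrank ℂ X : ℂ) ≠ 0 := Nat.cast_ne_zero.2 finrank_pos.ne'
  rw [mul_eq, traceCLM_smulRight, map_smul, traceCLM_one, smul_eq_mul, inv_mul_cancel₀ this]

section Average

variable {Φ : (X →L[ℂ] X) →ₗ[ℂ] (X →L[ℂ] X)}
  (μ : Measure (unitary (X →L[ℂ] X))) [IsProbabilityMeasure μ] [μ.IsMulLeftInvariant]

theorem integral_traceCLM_smul_unitaryConj (htr : IsTracePreserving Φ) (h1 : Φ 1 = 1)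
    (hX : 2 ≤ finrank ℂ X) :
    (∫ u, traceCLM (X →L[ℂ] X) (unitaryConj u⁻¹ * Φ.toContinuousLinearMap) • unitaryConj u ∂μ) =
      LinearMap.toContinuousLinearMap (((finrank ℂ X : ℝ) ^ 2 - 1)⁻¹ • Φ +
        (1 - ((finrank ℂ X : ℝ) ^ 2 - 1)⁻¹) • completelyDepolarizing X X) := by
  ext1 A
  have d_ne_zero : (finrank ℂ X : ℂ) ≠ 0 := by
    exact_mod_cast (by lia : finrank ℂ X ≠ 0)
  have sq_sub_one_ne_zero : (finrank ℂ X : ℂ) ^ 2 - 1 ≠ 0 := by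
    rw [sub_ne_zero]
    exact_mod_cast (by nlinarith : finrank ℂ X ^ 2 ≠ 1)
  have traceCLM_apply_eq (B : X →L[ℂ] X) : traceCLM X (Φ B) = traceCLM X B := htr B
  apply smul_right_injective _ (mul_ne_zero d_ne_zero sq_sub_one_ne_zero)
  dsimp only
  rw [smul_integral_traceCLM_smul_unitaryConj_apply]
  simp only [LinearMap.coe_toContinuousLinearMap', h1, traceCLM_apply_eq, traceCLM_one,
    LinearMap.add_apply, LinearMap.smul_apply, completelyDepolarizing_apply, ← Complex.coe_smul]
  push_cast
  match_scalars <;> field_simp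
  ring

theorem integral_traceCLM_unitaryConj_mul (htr : IsTracePreserving Φ) (h1 : Φ 1 = 1)
    (hX : 2 ≤ finrank ℂ X) :
    ∫ u, traceCLM (X →L[ℂ] X) (unitaryConj u⁻¹ * Φ.toContinuousLinearMap) ∂μ = 1 := by
  have : Nontrivial X := nontrivial_of_finrank_pos (zero_lt_two.trans_le hX)
  have continuous_conj := continuous_unitaryConj (𝒜 := X →L[ℂ] X)
  have integral_smul_one : (∫ u, traceCLM (X →L[ℂ] X)
      (unitaryConj u⁻¹ * Φ.toContinuousLinearMap) ∂μ) • (1 : X →L[ℂ] X) = 1 := calc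
    _ = ∫ u, (traceCLM (X →L[ℂ] X) (unitaryConj u⁻¹ * Φ.toContinuousLinearMap) •
          unitaryConj u) (1 : X →L[ℂ] X) ∂μ := by
      simp only [smul_apply, unitaryConj_apply_one, integral_smul_const]
    _ = (((finrank ℂ X : ℝ) ^ 2 - 1)⁻¹ • Φ +
          (1 - ((finrank ℂ X : ℝ) ^ 2 - 1)⁻¹) • completelyDepolarizing X X) 1 := by
      rw [← ContinuousLinearMap.integral_apply
        (integrable_of_continuous_of_compactSpace (by fun_prop)),
        integral_traceCLM_smul_unitaryConj μ htr h1 hX, LinearMap.coe_toContinuousLinearMap']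
    _ = 1 := by
      rw [LinearMap.add_apply, LinearMap.smul_apply, LinearMap.smul_apply, h1,
        completelyDepolarizing_apply_one rfl, ← add_smul, add_sub_cancel, one_smul]
  exact smul_left_injective ℂ one_ne_zero (integral_smul_one.trans (one_smul ℂ 1).symm)

end Average

theorem isMixedUnitary_inv_smul_add_smul_completelyDepolarizing
    {Φ : (X →L[ℂ] X) →ₗ[ℂ] (X →L[ℂ] X)} (htr : IsTracePreserving Φ) (h1 : Φ 1 = 1)
    (hX : 2 ≤ finrank ℂ X)
    (h0 : ∀ u, 0 ≤ traceCLM (X →L[ℂ] X) (unitaryConj u * Φ.toContinuousLinearMap)) :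
    IsMixedUnitary (((finrank ℂ X : ℝ) ^ 2 - 1)⁻¹ • Φ +
      (1 - ((finrank ℂ X : ℝ) ^ 2 - 1)⁻¹) • completelyDepolarizing X X) := by
  obtain ⟨μ, _, _⟩ := exists_isProbabilityMeasure_isMulLeftInvariant (unitary (X →L[ℂ] X))
  have : FiniteDimensional ℝ ((X →L[ℂ] X) →L[ℂ] (X →L[ℂ] X)) := FiniteDimensional.complexToReal _
  have continuous_conj := continuous_unitaryConj (𝒜 := X →L[ℂ] X)
  let weight (u : unitary (X →L[ℂ] X)) : NNReal :=
    (traceCLM (X →L[ℂ] X) (unitaryConj u⁻¹ * Φ.toContinuousLinearMap)).re.toNNReal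
  have coe_weight (u) : ((weight u : ℝ) : ℂ) =
      traceCLM (X →L[ℂ] X) (unitaryConj u⁻¹ * Φ.toContinuousLinearMap) := by
    rw [Real.coe_toNNReal _ (Complex.le_def.1 (h0 u⁻¹)).1]
    exact (Complex.eq_re_of_ofReal_le (r := 0) (h0 u⁻¹)).symm
  have integral_weight : ∫ u, (weight u : ℝ) ∂μ = 1 := by
    apply Complex.ofReal_injective
    simp only [← integral_complex_ofReal, coe_weight,
      integral_traceCLM_unitaryConj_mul μ htr h1 hX, Complex.ofReal_one]
  have weight_smul (u) : weight u • (unitaryConj u : (X →L[ℂ] X) →L[ℂ] (X →L[ℂ] X)) =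
      traceCLM (X →L[ℂ] X) (unitaryConj u⁻¹ * Φ.toContinuousLinearMap) • unitaryConj u := by
    rw [← coe_weight, Complex.coe_smul, NNReal.smul_def]
  have mem_convexHull := integral_smul_mem_convexHull_range (μ := μ) (w := weight) (by fun_prop)
    integral_weight continuous_conj
  simp only [weight_smul, integral_traceCLM_smul_unitaryConj μ htr h1 hX] at mem_convexHull
  exact isMixedUnitary_of_mem_convexHull_range_unitaryConj mem_convexHull

theorem isMixedUnitary_completelyDepolarizing (hX : 2 ≤ finrank ℂ X) :
    IsMixedUnitary (completelyDepolarizing X X) := by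
  have : Nontrivial X := nontrivial_of_finrank_pos (zero_lt_two.trans_le hX)
  have isMixedUnitary := isMixedUnitary_inv_smul_add_smul_completelyDepolarizing
    isTracePreserving_completelyDepolarizing (completelyDepolarizing_apply_one rfl) hX fun u ↦
      (traceCLM_unitaryConj_mul_completelyDepolarizing u).symm ▸ zero_le_one
  rwa [← add_smul, add_sub_cancel, one_smul] at isMixedUnitary

theorem IsDoublyStochastic.isMixedUnitary_smul_add_smul_completelyDepolarizing
    {Φ : (X →L[ℂ] X) →ₗ[ℂ] (X →L[ℂ] X)} (hΦ : IsDoublyStochastic Φ) (hX : 2 ≤ finrank ℂ X)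
    {p : ℝ} (hp0 : 0 ≤ p) (hp1 : ((finrank ℂ X : ℝ) ^ 2 - 1) * p ≤ 1) :
    IsMixedUnitary (p • Φ + (1 - p) • completelyDepolarizing X X) := by
  have sq_sub_one_pos : 0 < (finrank ℂ X : ℝ) ^ 2 - 1 := by
    have : (2 : ℝ) ≤ finrank ℂ X := by exact_mod_cast hX
    nlinarith
  have isMixedUnitary_inv := isMixedUnitary_inv_smul_add_smul_completelyDepolarizing
    hΦ.tracePreserving hΦ.unital hX hΦ.completelyPositive.traceCLM_unitaryConj_mul_nonneg
  convert isMixedUnitary_inv.smul_add_one_sub_smul (isMixedUnitary_completelyDepolarizing hX)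
    (mul_nonneg sq_sub_one_pos.le hp0) hp1 using 1
  match_scalars <;> field_simp
  ring

end Depolarizing

theorem theorem1 {X Y : Type*}
    [NormedAddCommGroup X] [InnerProductSpace ℂ X] [FiniteDimensional ℂ X] [CompleteSpace X]
    [NormedAddCommGroup Y] [InnerProductSpace ℂ Y] [FiniteDimensional ℂ Y] [CompleteSpace Y]
    (d : ℕ) (hX : Module.finrank ℂ X = d) (hY : Module.finrank ℂ Y = d)
    (Φ : (X →L[ℂ] X) →ₗ[ℂ] (Y →L[ℂ] Y)) (hΦ : IsDoublyStochastic Φ)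
    (p : ℝ) (hp0 : 0 ≤ p) (hp1 : ((d : ℝ) ^ 2 - 1) * p ≤ 1) :
    IsMixedUnitary (p • Φ + (1 - p) • completelyDepolarizing X Y) := by
  let U : X ≃ₗᵢ[ℂ] Y :=
    (stdOrthonormalBasis ℂ X).equiv (stdOrthonormalBasis ℂ Y) (finCongr (hX.trans hY.symm))
  obtain hd | hd := Nat.lt_or_ge d 2
  · have eq_unitaryChannel :
        p • Φ + (1 - p) • completelyDepolarizing X Y = unitaryChannel U := by
      apply eq_of_apply_one_eq_of_finrank_le_one (by lia)
      rw [unitaryChannel_apply_one, LinearMap.add_apply, LinearMap.smul_apply,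
        LinearMap.smul_apply, hΦ.unital, completelyDepolarizing_apply_one (hX.trans hY.symm),
        ← add_smul, add_sub_cancel, one_smul]
    rw [eq_unitaryChannel]
    exact isMixedUnitary_unitaryChannel U
  · have isMixedUnitary :=
      (hΦ.unitaryChannel_comp U.symm).isMixedUnitary_smul_add_smul_completelyDepolarizing
        (hX ▸ hd) hp0 (hX ▸ hp1)
    have := isMixedUnitary.unitaryChannel_comp U
    rwa [LinearMap.comp_add, LinearMap.comp_smul, LinearMap.comp_smul,
      unitaryChannel_comp_symm_comp, unitaryChannel_comp_completelyDepolarizing] at this
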